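/- Let $p>0$ be real, let $0<\lambda_1<\lambda_2<\cdots$ be the positive roots of the equation $p\sin(\pi\lambda)+\lambda\cos(\pi\lambda)=0$, and put $$\sigma_p(t)=\sum_{j=1}^{\infty}\frac{p^2+\lambda_j^2}{p\left(p+\frac1\pi\right)+\lambda_j^2}\,e^{-\lambda_j t}\quad(t>0),\qquad \sigma(x)=\frac{p+x}{p-x}.$$ There is a unique sequence of real numbers $(B_n^{(2,p)})_{n\ge 0}$ (the generalized Bernoulli numbers of the second kind) with $$\sum_{n=0}^{\infty}\frac{B_n^{(2,p)}}{n!}\,t^n=t\,\sigma_p(t)\qquad(0<t<1).$$ It satisfies $B_0^{(2,p)}=1$ and, for every integer $m\ge 1$, $$B_{2m}^{(2,p)}=4m(-1)^{m+1}\int_0^\infty\frac{x^{2m-1}}{\sigma(x)e^{2\pi x}-1}\,dx,$$ where the integral converges absolutely. (The integrand extends continuously by $0$ to $x=p$, where $\sigma$ has its pole.) -/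

import Mathlib

noncomputable section

/-- The roots `λ_1 < λ_2 < ⋯` of `p * sin (π x) + x * cos (π x) = 0` in `(0, ∞)`, listed in
increasing order: `koshliakovRoot p j` is `λ_j` for `j ≥ 1`. The recursion starts from the root
`0` (the value at index `0`), and the root number `j + 1` is the least one beyond number `j`. -/
def koshliakovRoot (p : ℝ) : ℕ → ℝ
  | 0 => 0
  | j + 1 => sInf {x : ℝ | koshliakovRoot p j < x ∧
      p * Real.sin (Real.pi * x) + x * Real.cos (Real.pi * x) = 0}

/-- `σ_p(t) = ∑_{j ≥ 1} (p² + λ_j²) / (p (p + 1/π) + λ_j²) * exp (-λ_j t)` (for `t > 0`). -/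
def koshliakovSeries (p t : ℝ) : ℝ :=
  ∑' j : ℕ, (p ^ 2 + koshliakovRoot p (j + 1) ^ 2) /
      (p * (p + 1 / Real.pi) + koshliakovRoot p (j + 1) ^ 2) *
    Real.exp (-koshliakovRoot p (j + 1) * t)

/-- `σ(x) = (p + x) / (p - x)`. -/
def koshliakovSigma (p x : ℝ) : ℝ := (p + x) / (p - x)

/-- `B` has the exponential generating function `t * σ_p(t)` on `0 < t < 1`. -/
def HasSecondKindGenFun (p : ℝ) (B : ℕ → ℝ) : Prop :=
  ∀ t : ℝ, 0 < t → t < 1 →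
    HasSum (fun n : ℕ => B n / (n.factorial : ℝ) * t ^ n) (t * koshliakovSeries p t)

/-- The generalized Bernoulli numbers of the second kind `B_n^{(2,p)}`: the sequence whose
exponential generating function is `t * σ_p(t)`. -/
def bernoulliSecondKind (p : ℝ) : ℕ → ℝ :=
  Classical.epsilon (HasSecondKindGenFun p)

end

/-! The proof is an Abel–Plana summation over the roots. With `h = secularFun p`, the quotient `f =
abelPlanaNum p t / h` has simple poles exactly at the roots, as far as the closed first quadrant is
concerned. Its residue at a root `λ` is `1/π` times the summand of `σ_p(t)` at `λ`. On the positive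
real axis `Im f = exp (-t x)` off the roots, and on the positive imaginary axis `Re f = -2 sin (t y)
K(y)`, where `K = abelPlanaKernel p`.

Take the imaginary part of Cauchy's theorem on the square `[0, N] × [0, N]`. The poles lie on the
bottom side, so each counts with `π` instead of `2π`, and the corner pole `0` with `π/2`. Since the
top and right sides tend to zero (`koshliakov_partial_sum`), `σ_p(t) = 1/t - c + 2 ∫ sin (t y) K(y)
dy` over `(0, ∞)`, with `c` half the value of the summand at the root `0` (`koshliakovSeries_eq`).

Expanding the sine and integrating termwise gives the power series of `t σ_p(t)`: the constant term
is `1`, the linear one comes from `c`, and the even ones are the moments of `K`. Uniqueness of the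
coefficients is the identity theorem. -/

/-! ### Location of the roots: exactly one in each interval `(j + 1/2, j + 1)`. -/

theorem secular_shift (p x : ℝ) (j : ℕ) :
    p * Real.sin (Real.pi * x) + x * Real.cos (Real.pi * x) = 0 ↔
      p * Real.sin (Real.pi * (x - j)) + x * Real.cos (Real.pi * (x - j)) = 0 := by
  have e : Real.pi * (x - j) = Real.pi * x - j * Real.pi := by ring
  rw [e, Real.sin_sub_nat_mul_pi, Real.cos_sub_nat_mul_pi,
    show p * ((-1) ^ j * Real.sin (Real.pi * x)) + x * ((-1) ^ j * Real.cos (Real.pi * x)) =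
      (-1) ^ j * (p * Real.sin (Real.pi * x) + x * Real.cos (Real.pi * x)) by ring]
  simp

/-- After shifting the angle by `j π`, sine and cosine are both nonnegative and do not vanish
together. -/
theorem secular_ne_zero_of_mem_Icc {p x : ℝ} (hp : 0 < p) (hx : 0 < x) (j : ℕ)
    (h1 : j ≤ x) (h2 : x ≤ j + 1 / 2) :
    p * Real.sin (Real.pi * x) + x * Real.cos (Real.pi * x) ≠ 0 := by
  rw [Ne, secular_shift p x j]
  have hpi := Real.pi_pos
  rcases h2.lt_or_eq with h2 | h2
  · have hs : 0 ≤ Real.sin (Real.pi * (x - j)) :=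
      Real.sin_nonneg_of_nonneg_of_le_pi (by nlinarith) (by nlinarith)
    have hc : 0 < Real.cos (Real.pi * (x - j)) :=
      Real.cos_pos_of_mem_Ioo ⟨by nlinarith, by nlinarith⟩
    positivity
  · have : Real.pi * (x - j) = Real.pi / 2 := by rw [h2]; ring
    rw [this]
    simpa using hp.ne'

/-- The equation reads `p tan (π x) = -x`, with an increasing left side and a decreasing right side
on this interval. Cleared of denominators, the contradiction is with `sin (π y - π x) > 0`. -/
theorem secular_root_unique {p x y : ℝ} (hp : 0 < p) (j : ℕ) (hxj : (j : ℝ) + 1 / 2 < x)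
    (hxy : x < y) (hyj : y < j + 1)
    (hx : p * Real.sin (Real.pi * x) + x * Real.cos (Real.pi * x) = 0)
    (hy : p * Real.sin (Real.pi * y) + y * Real.cos (Real.pi * y) = 0) : False := by
  have hpi := Real.pi_pos
  rw [secular_shift p _ (j + 1)] at hx hy
  push_cast at hx hy
  have hcx : 0 < Real.cos (Real.pi * (x - (j + 1))) :=
    Real.cos_pos_of_mem_Ioo ⟨by nlinarith, by nlinarith⟩
  have hcy : 0 < Real.cos (Real.pi * (y - (j + 1))) :=
    Real.cos_pos_of_mem_Ioo ⟨by nlinarith, by nlinarith⟩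
  have hs : 0 < Real.sin (Real.pi * (y - (j + 1)) - Real.pi * (x - (j + 1))) :=
    Real.sin_pos_of_pos_of_lt_pi (by nlinarith) (by nlinarith)
  rw [Real.sin_sub] at hs
  have := mul_pos hp hs
  have h3 := mul_pos (mul_pos hcx hcy) (sub_pos.2 hxy)
  nlinarith

theorem exists_secular_root {p : ℝ} (hp : 0 < p) (j : ℕ) :
    ∃ x ∈ Set.Ioo ((j : ℝ) + 1 / 2) (j + 1),
      p * Real.sin (Real.pi * x) + x * Real.cos (Real.pi * x) = 0 := by
  set G : ℝ → ℝ := fun x => p * Real.sin (Real.pi * (x - (j + 1 : ℕ))) +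
    x * Real.cos (Real.pi * (x - (j + 1 : ℕ))) with hG
  have hc : ContinuousOn G (Set.Icc ((j : ℝ) + 1 / 2) (j + 1)) := by
    rw [hG]; fun_prop
  have h1 : G ((j : ℝ) + 1 / 2) = -p := by
    have : Real.pi * ((j : ℝ) + 1 / 2 - (j + 1 : ℕ)) = -(Real.pi / 2) := by push_cast; ring
    simp only [hG, this]; simp
  have h2 : G ((j : ℝ) + 1) = j + 1 := by simp [hG]
  obtain ⟨x, hx, hx0⟩ := intermediate_value_Ioo (by linarith) hc
    (show (0 : ℝ) ∈ Set.Ioo _ _ by rw [h1, h2]; constructor <;> [linarith; positivity])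
  exact ⟨x, hx, (secular_shift p x (j + 1)).2 hx0⟩

/-- These facts must be proved by one induction: the absence of roots in `(λ_j, j]` is what forces
the infimum defining the next root into `(j + 1/2, j + 1)`. -/
theorem koshliakovRoot_spec {p : ℝ} (hp : 0 < p) (j : ℕ) :
    p * Real.sin (Real.pi * koshliakovRoot p j) +
        koshliakovRoot p j * Real.cos (Real.pi * koshliakovRoot p j) = 0 ∧
      koshliakovRoot p j ≤ j ∧
      (∀ x, p * Real.sin (Real.pi * x) + x * Real.cos (Real.pi * x) = 0 →
        koshliakovRoot p j < x → j < x) ∧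
      koshliakovRoot p (j + 1) ∈ Set.Ioo ((j : ℝ) + 1 / 2) (j + 1) := by
  have step : ∀ j : ℕ, koshliakovRoot p j ≤ j →
      (∀ x, p * Real.sin (Real.pi * x) + x * Real.cos (Real.pi * x) = 0 →
        koshliakovRoot p j < x → j < x) →
      ∃ μ ∈ Set.Ioo ((j : ℝ) + 1 / 2) (j + 1),
        p * Real.sin (Real.pi * μ) + μ * Real.cos (Real.pi * μ) = 0 ∧
        koshliakovRoot p (j + 1) = μ := by
    intro j h2 h3
    obtain ⟨μ, hμ, hμ0⟩ := exists_secular_root hp j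
    refine ⟨μ, hμ, hμ0, ?_⟩
    have hl : IsLeast {x : ℝ | koshliakovRoot p j < x ∧
        p * Real.sin (Real.pi * x) + x * Real.cos (Real.pi * x) = 0} μ := by
      refine ⟨⟨by linarith [hμ.1], hμ0⟩, fun x ⟨hx1, hx2⟩ => ?_⟩
      by_contra! hlt
      have hj := h3 x hx2 hx1
      rcases le_or_gt x (j + 1 / 2) with h | h
      · exact secular_ne_zero_of_mem_Icc hp (lt_of_le_of_lt j.cast_nonneg hj) j hj.le h hx2
      · exact secular_root_unique hp j h hlt hμ.2 hx2 hμ0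
    rw [koshliakovRoot, hl.csInf_eq]
  induction j with
  | zero =>
    have h2 : koshliakovRoot p 0 ≤ (0 : ℕ) := by simp [koshliakovRoot]
    have h3 : ∀ x, p * Real.sin (Real.pi * x) + x * Real.cos (Real.pi * x) = 0 →
        koshliakovRoot p 0 < x → (0 : ℕ) < x := by simp [koshliakovRoot]
    obtain ⟨μ, hμ, _, h⟩ := step 0 h2 h3
    exact ⟨by simp [koshliakovRoot], h2, h3, h ▸ hμ⟩
  | succ j ih =>
    obtain ⟨h1, h2, h3, h4⟩ := ih
    obtain ⟨μ, hμ, hμ0, h⟩ := step j h2 h3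
    have h2' : koshliakovRoot p (j + 1) ≤ (j + 1 : ℕ) := by
      rw [h]; push_cast; exact hμ.2.le
    have h3' : ∀ x, p * Real.sin (Real.pi * x) + x * Real.cos (Real.pi * x) = 0 →
        koshliakovRoot p (j + 1) < x → (j + 1 : ℕ) < x := by
      intro x hx hlt
      rw [h] at hlt
      push_cast
      by_contra! hle
      rcases hle.lt_or_eq with hle | hle
      · exact secular_root_unique hp j hμ.1 hlt hle hμ0 hx
      · refine secular_ne_zero_of_mem_Icc hp (by rw [hle]; positivity) (j + 1) ?_ ?_ hx <;>
          push_cast <;> linarith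
    obtain ⟨ν, hν, _, h'⟩ := step (j + 1) h2' h3'
    exact ⟨h ▸ hμ0, h2', h3', h' ▸ hν⟩

/-- The bound on `j` ensures that the roots in `[0, N]` are among those with index at most `N`. -/
theorem exists_eq_koshliakovRoot {p x : ℝ} (hp : 0 < p) (hx : 0 ≤ x)
    (h : p * Real.sin (Real.pi * x) + x * Real.cos (Real.pi * x) = 0) :
    ∃ j : ℕ, (j : ℝ) < x + 1 ∧ koshliakovRoot p j = x := by
  rcases hx.eq_or_lt with rfl | hx
  · exact ⟨0, by simp, rfl⟩
  have h1 := Nat.floor_le hx.le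
  have h2 := Nat.lt_floor_add_one x
  set j := ⌊x⌋₊
  have h3 : (j : ℝ) + 1 / 2 < x := by
    by_contra! hle
    exact secular_ne_zero_of_mem_Icc hp hx j h1 hle h
  refine ⟨j + 1, by push_cast; linarith, ?_⟩
  have h4 := (koshliakovRoot_spec hp j).2.2.2
  have h5 := (koshliakovRoot_spec hp (j + 1)).1
  rcases lt_trichotomy (koshliakovRoot p (j + 1)) x with hlt | heq | hgt
  · exact (secular_root_unique hp j h4.1 hlt h2 h5 h).elim
  · exact heq
  · exact (secular_root_unique hp j h3 hgt h4.2 h h5).elim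

theorem koshliakovRoot_strictMono {p : ℝ} (hp : 0 < p) : StrictMono (koshliakovRoot p) :=
  strictMono_nat_of_lt_succ fun j => by
    obtain ⟨-, h2, -, h4⟩ := koshliakovRoot_spec hp j
    linarith [h4.1]

theorem koshliakovRoot_lt {p : ℝ} (hp : 0 < p) {j N : ℕ} (hj : j ≤ N) (hN : 0 < N) :
    koshliakovRoot p j < N := by
  refine ((koshliakovRoot_strictMono hp).monotone hj).trans_lt ?_
  obtain ⟨n, rfl⟩ := Nat.exists_eq_succ_of_ne_zero hN.ne'
  simpa using (koshliakovRoot_spec hp n).2.2.2.2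

/-! ### Cauchy's theorem on a square with simple poles on its bottom side. -/

/-- Write `h z = (z - a) D z` with `D a = h'(a) ≠ 0`. The difference is then the difference quotient
of `A / D` at `a`, so it tends to a derivative. -/
theorem tendsto_sub_residue_of_simple_zero {A h : ℂ → ℂ} (hA : Differentiable ℂ A)
    (hh : Differentiable ℂ h) {a : ℂ} (h0 : h a = 0) (h1 : deriv h a ≠ 0) :
    ∃ L, Filter.Tendsto (fun z => A z / h z - A a / deriv h a / (z - a))
      (nhdsWithin a {a}ᶜ) (nhds L) := by
  set D := dslope h a with hD
  have hDd : Differentiable ℂ D := by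
    rw [← differentiableOn_univ] at hh ⊢
    exact (Complex.differentiableOn_dslope Filter.univ_mem).2 hh
  have hDa : D a ≠ 0 := by rwa [hD, dslope_same]
  have hev : ∀ᶠ z in nhds a, D z ≠ 0 := hDd.continuous.continuousAt.eventually_ne hDa
  have hdiff : DifferentiableAt ℂ (fun z => A z / D z) a := (hA a).div (hDd a) hDa
  refine ⟨dslope (fun z => A z / D z) a a, ?_⟩
  have hc := (continuousAt_dslope_same.2 hdiff).tendsto.mono_left
    (nhdsWithin_le_nhds (s := {a}ᶜ))
  refine hc.congr' ?_
  filter_upwards [self_mem_nhdsWithin, nhdsWithin_le_nhds hev] with z hz hDz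
  have hza : z - a ≠ 0 := sub_ne_zero.2 hz
  have hzh : h z = (z - a) * D z := by
    rw [hD, dslope_of_ne _ hz, slope_def_field, h0]; field_simp; ring
  have hda : D a = deriv h a := dslope_same _ _
  rw [dslope_of_ne _ hz, slope_def_field, hzh, hda]
  rw [hda] at hDa
  field_simp

theorem arctan_div_add_arctan_div {a b : ℝ} (ha : 0 < a) (hb : 0 < b) :
    Real.arctan (a / b) + Real.arctan (b / a) = Real.pi / 2 := by
  rw [← inv_div a b, Real.arctan_inv_of_pos (div_pos ha hb)]; ring

theorem re_inv_add_mul_I (u y : ℝ) : ((1 : ℂ) / (u + y * Complex.I)).re = u / (u ^ 2 + y ^ 2) := by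
  simp [Complex.normSq_apply, sq]

theorem im_inv_add_mul_I (u y : ℝ) :
    ((1 : ℂ) / (u + y * Complex.I)).im = -(y / (y ^ 2 + u ^ 2)) := by
  simp [Complex.normSq_apply, sq, add_comm, neg_div]

theorem intervalIntegral_eq_add_sum_of_eq_off_finset {N : ℝ} (hN : 0 < N) (s : Finset ℝ) (r : ℝ → ℝ)
    (φ γ : ℝ → ℝ) (ψ : ℝ → ℝ → ℝ) (hγ : ContinuousOn γ (Set.Icc 0 N))
    (hψ : ∀ a ∈ s, IntervalIntegrable (ψ a) MeasureTheory.volume 0 N)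
    (h : ∀ x ∈ Set.Ioc 0 N, x ∉ s → φ x = γ x + ∑ a ∈ s, r a * ψ a x) :
    ∫ x in (0 : ℝ)..N, φ x =
      (∫ x in (0 : ℝ)..N, γ x) + ∑ a ∈ s, r a * ∫ x in (0 : ℝ)..N, ψ a x := by
  have hi : IntervalIntegrable γ MeasureTheory.volume 0 N :=
    ContinuousOn.intervalIntegrable (by rwa [Set.uIcc_of_le hN.le])
  have e : ∫ x in (0 : ℝ)..N, φ x = ∫ x in (0 : ℝ)..N, (γ x + ∑ a ∈ s, r a * ψ a x) := by
    refine intervalIntegral.integral_congr_ae ?_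
    have : ∀ᵐ x : ℝ, x ∉ (s : Set ℝ) :=
      MeasureTheory.measure_eq_zero_iff_ae_notMem.1 (s.finite_toSet.measure_zero _)
    filter_upwards [this] with x hx hx'
    rw [Set.uIoc_of_le hN.le] at hx'
    exact h x hx' hx
  rw [e, intervalIntegral.integral_add hi, intervalIntegral.integral_finsetSum]
  · simp
  · exact fun a ha => (hψ a ha).const_mul _
  · simpa only [Finset.sum_fn] using IntervalIntegrable.sum s (fun a ha => (hψ a ha).const_mul (r a))

-- Subtracting the principal parts leaves a function that extends continuously to the closed square,
-- so its boundary integral vanishes. The principal parts are integrated by arctangents. As the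
-- residues are real, `r / (x - a)` is real on the bottom side and the pole at `0` is imaginary on
-- the left side; the chosen components never meet a singularity, and no principal value is needed.
open Complex in
theorem integral_boundary_square_of_real_poles (f : ℂ → ℂ) (s : Finset ℝ) (r : ℝ → ℝ) {N : ℝ}
    (hN : 0 < N) (hs : ∀ a ∈ s, 0 ≤ a ∧ a < N)
    (hf : ∀ z : ℂ, z.re ∈ Set.Icc 0 N → z.im ∈ Set.Icc 0 N → (∀ a ∈ s, z ≠ (a : ℂ)) →
      DifferentiableAt ℂ f z)
    (hl : ∀ a ∈ s, ∃ L, Filter.Tendsto (fun z : ℂ => f z - r a / (z - a))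
      (nhdsWithin (a : ℂ) {(a : ℂ)}ᶜ) (nhds L)) :
    (∫ x in (0 : ℝ)..N, (f x).im) - (∫ x in (0 : ℝ)..N, (f (x + N * I)).im) +
        (∫ y in (0 : ℝ)..N, (f (N + y * I)).re) - (∫ y in (0 : ℝ)..N, (f (y * I)).re) =
      ∑ a ∈ s, r a * (if a = 0 then Real.pi / 2 else Real.pi) := by
  set S : Set ℂ := (fun a : ℝ => (a : ℂ)) '' (s : Set ℝ) with hS
  have hSf : S.Finite := s.finite_toSet.image _
  have hmemS : ∀ z : ℂ, z ∉ S ↔ ∀ a ∈ s, z ≠ (a : ℂ) := by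
    intro z; simp [hS, eq_comm]
  set g₀ : ℂ → ℂ := fun z => f z - ∑ a ∈ s, r a / (z - a) with hg₀
  set B : Set ℂ := Set.Icc 0 N ×ℂ Set.Icc 0 N with hB
  -- At a pole `g₀` has a meaningless value; `g` takes the limit there.
  set g := extendFrom Sᶜ g₀ with hg
  have hdense : Dense Sᶜ := hSf.countable.dense_compl ℝ
  have hd₀ : ∀ z ∈ B, z ∉ S → DifferentiableAt ℂ g₀ z := by
    intro z hz hzS
    rw [hmemS] at hzS
    refine (hf z hz.1 hz.2 hzS).sub (DifferentiableAt.fun_sum fun a ha => ?_)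
    exact (differentiableAt_const _).div (by fun_prop) (sub_ne_zero.2 (hzS a ha))
  have hlim : ∀ z ∈ B, ∃ y, Filter.Tendsto g₀ (nhdsWithin z Sᶜ) (nhds y) := by
    intro z hz
    by_cases hzS : z ∈ S
    · obtain ⟨a, ha, rfl⟩ := hzS
      have ha : a ∈ s := ha
      obtain ⟨L, hL⟩ := hl a ha
      have h2 : ContinuousAt (fun z : ℂ => ∑ b ∈ s.erase a, (r b : ℂ) / (z - b)) (a : ℂ) := by
        refine tendsto_finsetSum _ fun b hb => ?_
        refine ContinuousAt.div (by fun_prop) (by fun_prop) (sub_ne_zero.2 ?_)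
        exact_mod_cast (Finset.ne_of_mem_erase hb).symm
      have h3 := hL.sub (h2.tendsto.mono_left (nhdsWithin_le_nhds (s := {(a : ℂ)}ᶜ)))
      refine ⟨_, (h3.mono_left (nhdsWithin_mono _ ?_)).congr fun z => ?_⟩
      · intro z hz hza
        exact hz (hza ▸ ⟨a, ha, rfl⟩)
      · simp only [hg₀]
        rw [← Finset.add_sum_erase s _ ha]; ring
    · exact ⟨_, (hd₀ z hz hzS).continuousAt.tendsto.mono_left nhdsWithin_le_nhds⟩
  have hgc : ContinuousOn g B := continuousOn_extendFrom (by simp [hdense.closure_eq]) hlim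
  have hge : ∀ z ∈ B, z ∉ S → g z = g₀ z := fun z hz hzS =>
    extendFrom_eq (by simp [hdense.closure_eq])
      ((hd₀ z hz hzS).continuousAt.tendsto.mono_left nhdsWithin_le_nhds)
  have him : ∀ z : ℂ, z.im ≠ 0 → z ∉ S := by
    rintro z hz ⟨a, -, rfl⟩; simp at hz
  have hC := integral_boundary_rect_eq_zero_of_continuousOn_of_differentiableOn g 0 (N + N * I)
    (by simpa [Set.uIcc_of_le hN.le] using hgc) (by
      simp only [zero_re, zero_im, add_re, ofReal_re, mul_re, I_re, I_im, ofReal_im, add_im,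
        mul_im, mul_zero, mul_one, sub_zero, add_zero, zero_add, min_eq_left hN.le,
        max_eq_right hN.le]
      intro z hz
      have hzS := him z hz.2.1.ne'
      have hzB : z ∈ B := ⟨Set.Ioo_subset_Icc_self hz.1, Set.Ioo_subset_Icc_self hz.2⟩
      refine ((hd₀ z hzB hzS).differentiableWithinAt).congr (fun w hw => ?_) (hge z hzB hzS)
      exact hge w ⟨Set.Ioo_subset_Icc_self hw.1, Set.Ioo_subset_Icc_self hw.2⟩ (him w hw.2.1.ne'))
  simp only [zero_re, zero_im, add_re, ofReal_re, mul_re, I_re, I_im, ofReal_im, add_im,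
    mul_im, mul_zero, mul_one, sub_zero, add_zero, zero_add, ofReal_zero, zero_mul] at hC
  have cb : ContinuousOn (fun x : ℝ => g x) (Set.Icc 0 N) :=
    hgc.comp (by fun_prop) fun x hx => ⟨by simpa using hx, by simpa using hN.le⟩
  have ct : ContinuousOn (fun x : ℝ => g (x + N * I)) (Set.Icc 0 N) :=
    hgc.comp (by fun_prop) fun x hx => ⟨by simpa using hx, by simpa using hN.le⟩
  have cr : ContinuousOn (fun y : ℝ => g (N + y * I)) (Set.Icc 0 N) :=
    hgc.comp (by fun_prop) fun x hx => ⟨by simpa using hN.le, by simpa using hx⟩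
  have cl : ContinuousOn (fun y : ℝ => g (y * I)) (Set.Icc 0 N) :=
    hgc.comp (by fun_prop) fun x hx => ⟨by simpa using hN.le, by simpa using hx⟩
  have hre : ∀ φ : ℝ → ℂ, ContinuousOn φ (Set.Icc 0 N) →
      (∫ x in (0 : ℝ)..N, φ x).re = ∫ x in (0 : ℝ)..N, (φ x).re := fun φ hφ =>
    (reCLM.intervalIntegral_comp_comm
      (ContinuousOn.intervalIntegrable (by rwa [Set.uIcc_of_le hN.le]))).symm
  have hcomp_im : ∀ φ : ℝ → ℂ, ContinuousOn φ (Set.Icc 0 N) →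
      (∫ x in (0 : ℝ)..N, φ x).im = ∫ x in (0 : ℝ)..N, (φ x).im := fun φ hφ =>
    (imCLM.intervalIntegral_comp_comm
      (ContinuousOn.intervalIntegrable (by rwa [Set.uIcc_of_le hN.le]))).symm
  have hC' := congrArg Complex.im hC
  simp only [sub_im, add_im, smul_eq_mul, mul_im, I_re, I_im, zero_mul, one_mul, zero_add,
    zero_im] at hC'
  rw [hcomp_im _ cb, hcomp_im _ ct, hre _ cr, hre _ cl] at hC'
  have key : ∀ z ∈ B, z ∉ S → f z = g z + ∑ a ∈ s, r a * (1 / (z - a)) := by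
    intro z hz hzS
    rw [hge z hz hzS, hg₀]
    simp [div_eq_mul_inv]
  have keyre : ∀ z ∈ B, z ∉ S → (f z).re = (g z).re + ∑ a ∈ s, r a * (1 / (z - a)).re := by
    intro z hz hzS
    simp [key z hz hzS]
  have keyim : ∀ z ∈ B, z ∉ S → (f z).im = (g z).im + ∑ a ∈ s, r a * (1 / (z - a)).im := by
    intro z hz hzS
    simp [key z hz hzS]
  have eb := intervalIntegral_eq_add_sum_of_eq_off_finset hN s r (fun x => (f x).im) (fun x => (g x).im)
    (fun a x => 0) (continuous_im.comp_continuousOn cb) (fun a _ => by simp) (by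
      intro x hx hxs
      have hxB : (x : ℂ) ∈ B := ⟨by simpa using ⟨hx.1.le, hx.2⟩, by simpa using hN.le⟩
      rw [keyim x hxB ((hmemS _).2 fun a ha h => hxs (by rw [ofReal_inj] at h; rwa [h]))]
      refine congrArg _ (Finset.sum_congr rfl fun a _ => ?_)
      simp)
  have et := intervalIntegral_eq_add_sum_of_eq_off_finset hN s r (fun x => (f (x + N * I)).im)
    (fun x => (g (x + N * I)).im)
    (fun a x => -(N / (N ^ 2 + (x - a) ^ 2))) (continuous_im.comp_continuousOn ct)
    (fun a _ => by
      apply Continuous.intervalIntegrable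
      refine (continuous_const.div (by fun_prop) fun x => ?_).neg
      positivity) (by
      intro x hx _
      have hxB : (x + N * I : ℂ) ∈ B := ⟨by simpa using ⟨hx.1.le, hx.2⟩, by simpa using hN.le⟩
      rw [keyim _ hxB (him _ (by simpa using hN.ne'))]
      refine congrArg _ (Finset.sum_congr rfl fun a _ => ?_)
      rw [← im_inv_add_mul_I]; push_cast; ring_nf)
  have er := intervalIntegral_eq_add_sum_of_eq_off_finset hN s r (fun y => (f (N + y * I)).re)
    (fun y => (g (N + y * I)).re)
    (fun a y => (N - a) / ((N - a) ^ 2 + y ^ 2)) (continuous_re.comp_continuousOn cr)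
    (fun a ha => by
      apply Continuous.intervalIntegrable
      have := sub_pos.2 (hs a ha).2
      refine continuous_const.div (by fun_prop) fun x => ?_
      positivity) (by
      intro y hy _
      have hxB : (N + y * I : ℂ) ∈ B := ⟨by simpa using hN.le, by simpa using ⟨hy.1.le, hy.2⟩⟩
      rw [keyre _ hxB (him _ (by simpa using hy.1.ne'))]
      refine congrArg _ (Finset.sum_congr rfl fun a _ => ?_)
      rw [← re_inv_add_mul_I]; push_cast; ring_nf)
  have el := intervalIntegral_eq_add_sum_of_eq_off_finset hN s r (fun y => (f (y * I)).re)
    (fun y => (g (y * I)).re)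
    (fun a y => (-a) / ((-a) ^ 2 + y ^ 2)) (continuous_re.comp_continuousOn cl)
    (fun a ha => by
      rcases eq_or_ne a 0 with rfl | h
      · simp
      apply Continuous.intervalIntegrable
      refine continuous_const.div (by fun_prop) fun x => ?_
      have := pow_pos (lt_of_le_of_ne (hs a ha).1 (Ne.symm h)) 2
      rw [neg_sq]
      positivity) (by
      intro y hy _
      have hxB : (y * I : ℂ) ∈ B := ⟨by simpa using hN.le, by simpa using ⟨hy.1.le, hy.2⟩⟩
      rw [keyre _ hxB (him _ (by simpa using hy.1.ne'))]
      refine congrArg _ (Finset.sum_congr rfl fun a _ => ?_)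
      rw [← re_inv_add_mul_I]; push_cast; ring_nf)
  rw [eb, et, er, el]
  -- The arctangents pair to `π/2` at each of the two upper corners. For `a = 0` the left side
  -- contributes nothing and only one pair remains.
  have final : ∀ a ∈ s, (∫ x in (0 : ℝ)..N, -(N / (N ^ 2 + (x - a) ^ 2))) =
      (∫ y in (0 : ℝ)..N, (N - a) / ((N - a) ^ 2 + y ^ 2)) -
        (∫ y in (0 : ℝ)..N, (-a) / ((-a) ^ 2 + y ^ 2)) -
        (if a = 0 then Real.pi / 2 else Real.pi) := by
    intro a ha
    obtain ⟨h0, h1⟩ := hs a ha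
    rw [intervalIntegral.integral_neg,
      intervalIntegral.integral_comp_sub_right (fun x => N / (N ^ 2 + x ^ 2)) a,
      integral_div_sq_add_sq, integral_div_sq_add_sq, integral_div_sq_add_sq]
    have h2 := arctan_div_add_arctan_div (sub_pos.2 h1) hN
    split_ifs with h
    · subst h
      simp at h2 ⊢
      linarith
    · have h3 := arctan_div_add_arctan_div (lt_of_le_of_ne h0 (Ne.symm h)) hN
      simp [neg_div, div_neg]
      linarith
  simp only [intervalIntegral.integral_zero, mul_zero, Finset.sum_const_zero, add_zero]
  have e2 : ∑ a ∈ s, r a * (∫ x in (0 : ℝ)..N, -(N / (N ^ 2 + (x - a) ^ 2))) =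
      ∑ a ∈ s, r a * (∫ y in (0 : ℝ)..N, (N - a) / ((N - a) ^ 2 + y ^ 2)) -
        ∑ a ∈ s, r a * (∫ y in (0 : ℝ)..N, (-a) / ((-a) ^ 2 + y ^ 2)) -
        ∑ a ∈ s, r a * (if a = 0 then Real.pi / 2 else Real.pi) := by
    rw [← Finset.sum_sub_distrib, ← Finset.sum_sub_distrib]
    refine Finset.sum_congr rfl fun a ha => ?_
    rw [final a ha]; ring
  rw [e2]
  linarith

/-! ### The Abel–Plana integrand: residues, values on the axes, bounds on the far sides. -/

noncomputable section

/-- The function `2 (p sin (π z) + z cos (π z))`, in exponential form. -/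
def secularFun (p : ℝ) (z : ℂ) : ℂ :=
  (z - Complex.I * p) * Complex.exp (Complex.I * Real.pi * z) +
    (z + Complex.I * p) * Complex.exp (-(Complex.I * Real.pi * z))

/-- The numerator of the Abel–Plana integrand. -/
def abelPlanaNum (p t : ℝ) (z : ℂ) : ℂ :=
  Complex.exp (-(t * z)) *
    (2 * Complex.I * (z - Complex.I * p) * Complex.exp (Complex.I * Real.pi * z))

/-- The value at `y` of `1 / (σ(y) exp (2 π y) - 1)`, extended continuously to `y = p`. -/
def abelPlanaKernel (p y : ℝ) : ℝ :=
  (p - y) / ((p + y) * Real.exp (2 * Real.pi * y) - (p - y))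

theorem secularFun_eq (p : ℝ) (z : ℂ) :
    secularFun p z = 2 * (p * Complex.sin (Real.pi * z) + z * Complex.cos (Real.pi * z)) := by
  rw [secularFun, Complex.sin, Complex.cos,
    show (Real.pi * z * Complex.I : ℂ) = Complex.I * Real.pi * z by ring,
    show (-(Real.pi * z) * Complex.I : ℂ) = -(Complex.I * Real.pi * z) by ring]
  ring

theorem secularFun_ofReal (p x : ℝ) :
    secularFun p x =
      ((2 * (p * Real.sin (Real.pi * x) + x * Real.cos (Real.pi * x)) : ℝ) : ℂ) := by
  rw [secularFun_eq]; push_cast; rfl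

theorem abelPlanaNum_ofReal (p t x : ℝ) :
    abelPlanaNum p t x =
      ((2 * Real.exp (-(t * x)) * (p * Real.cos (Real.pi * x) - x * Real.sin (Real.pi * x)) : ℝ) : ℂ)
      + ((2 * Real.exp (-(t * x)) *
        (p * Real.sin (Real.pi * x) + x * Real.cos (Real.pi * x)) : ℝ) : ℂ) * Complex.I := by
  rw [abelPlanaNum, show (Complex.I * Real.pi * x : ℂ) = (Real.pi * x) * Complex.I by ring,
    Complex.exp_mul_I]
  push_cast
  linear_combination (-2 * Complex.exp (-(t * x)) * (p * Complex.cos (Real.pi * x) +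
    p * Complex.I * Complex.sin (Real.pi * x) - x * Complex.sin (Real.pi * x))) * Complex.I_sq

theorem differentiable_secularFun (p : ℝ) : Differentiable ℂ (secularFun p) := by
  unfold secularFun; fun_prop

theorem differentiable_abelPlanaNum (p t : ℝ) : Differentiable ℂ (abelPlanaNum p t) := by
  unfold abelPlanaNum; fun_prop

theorem deriv_secularFun (p x : ℝ) :
    deriv (secularFun p) x =
      ((2 * (Real.pi * (p * Real.cos (Real.pi * x) - x * Real.sin (Real.pi * x)) +
        Real.cos (Real.pi * x)) : ℝ) : ℂ) := by
  have h1 : HasDerivAt (fun z : ℂ => (Real.pi * z : ℂ)) Real.pi x := by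
    simpa using (hasDerivAt_id (x : ℂ)).const_mul (Real.pi : ℂ)
  have h2 := ((h1.csin.const_mul (p : ℂ)).add ((hasDerivAt_id (x : ℂ)).mul h1.ccos)).const_mul 2
  have h3 : HasDerivAt (secularFun p) _ x :=
    h2.congr_of_eventuallyEq (Filter.Eventually.of_forall fun z => secularFun_eq p z)
  rw [h3.deriv]
  push_cast
  simp only [id]
  ring

/-- At a root, `sin (π x) = -x cos (π x) / p`. Hence the cosine is nonzero, and it cancels from the
quotient. -/
theorem residue_at_secular_root {p : ℝ} (hp : 0 < p) (t : ℝ) {x : ℝ}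
    (hx : p * Real.sin (Real.pi * x) + x * Real.cos (Real.pi * x) = 0) :
    deriv (secularFun p) x ≠ 0 ∧
      abelPlanaNum p t x / deriv (secularFun p) x =
        (((p ^ 2 + x ^ 2) / (Real.pi * (p ^ 2 + x ^ 2) + p) * Real.exp (-(t * x)) : ℝ) : ℂ) := by
  have hpi := Real.pi_pos
  have hsin : Real.sin (Real.pi * x) = -(x * Real.cos (Real.pi * x)) / p := by
    field_simp; linarith
  have hcos : Real.cos (Real.pi * x) ≠ 0 := by
    intro h
    have := Real.sin_sq_add_cos_sq (Real.pi * x)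
    rw [hsin, h] at this
    simp at this
  have e1 : p * Real.cos (Real.pi * x) - x * Real.sin (Real.pi * x) =
      (p ^ 2 + x ^ 2) / p * Real.cos (Real.pi * x) := by
    rw [hsin]; field_simp; ring
  have e2 : 2 * (Real.pi * (p * Real.cos (Real.pi * x) - x * Real.sin (Real.pi * x)) +
        Real.cos (Real.pi * x)) =
      2 * ((Real.pi * (p ^ 2 + x ^ 2) + p) / p * Real.cos (Real.pi * x)) := by
    rw [e1]; field_simp
  have h3 : Real.pi * (p ^ 2 + x ^ 2) + p ≠ 0 := by positivity
  have h4 : 2 * ((Real.pi * (p ^ 2 + x ^ 2) + p) / p * Real.cos (Real.pi * x)) ≠ 0 :=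
    mul_ne_zero two_ne_zero (mul_ne_zero (div_ne_zero h3 hp.ne') hcos)
  rw [deriv_secularFun, abelPlanaNum_ofReal, hx, e2, e1]
  refine ⟨Complex.ofReal_ne_zero.2 h4, ?_⟩
  rw [mul_zero, Complex.ofReal_zero, zero_mul, add_zero, ← Complex.ofReal_div, Complex.ofReal_inj]
  generalize Real.cos (Real.pi * x) = c at hcos
  field_simp

theorem norm_exp_I_mul_pi_mul (z : ℂ) :
    ‖Complex.exp (Complex.I * Real.pi * z)‖ = Real.exp (-(Real.pi * z.im)) := by
  rw [Complex.norm_exp]; simp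

theorem norm_exp_neg_I_mul_pi_mul (z : ℂ) :
    ‖Complex.exp (-(Complex.I * Real.pi * z))‖ = Real.exp (Real.pi * z.im) := by
  rw [Complex.norm_exp]; simp

theorem norm_exp_neg_mul (t : ℝ) (z : ℂ) :
    ‖Complex.exp (-(t * z))‖ = Real.exp (-(t * z.re)) := by
  rw [Complex.norm_exp]; simp

theorem norm_sub_I_mul_le {p : ℝ} (hp : 0 < p) {z : ℂ} (hz : 0 ≤ z.im) :
    ‖z - Complex.I * p‖ ≤ ‖z + Complex.I * p‖ := by
  rw [← sq_le_sq₀ (norm_nonneg _) (norm_nonneg _), ← Complex.normSq_eq_norm_sq,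
    ← Complex.normSq_eq_norm_sq, Complex.normSq_apply, Complex.normSq_apply]
  simp
  nlinarith

theorem norm_add_I_mul_pos {p : ℝ} (hp : 0 < p) {z : ℂ} (hz : 0 ≤ z.im) :
    0 < ‖z + Complex.I * p‖ := by
  rw [norm_pos_iff]
  intro h
  have := congrArg Complex.im h
  simp at this
  linarith

/-- In the upper half-plane the term with `exp (-iπz)` dominates, as `z` is closer to `ip` than to
`-ip`. This excludes zeros off the real axis and controls the top side. -/
theorem le_norm_secularFun {p : ℝ} (hp : 0 < p) {z : ℂ} (hz : 0 ≤ z.im) :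
    ‖z + Complex.I * p‖ * (Real.exp (Real.pi * z.im) - Real.exp (-(Real.pi * z.im))) ≤
      ‖secularFun p z‖ := by
  have h := norm_sub_le_norm_add ((z + Complex.I * p) * Complex.exp (-(Complex.I * Real.pi * z)))
    ((z - Complex.I * p) * Complex.exp (Complex.I * Real.pi * z))
  have e : secularFun p z = (z + Complex.I * p) * Complex.exp (-(Complex.I * Real.pi * z)) +
      (z - Complex.I * p) * Complex.exp (Complex.I * Real.pi * z) := by rw [secularFun, add_comm]
  rw [← e, norm_mul, norm_mul, norm_exp_I_mul_pi_mul,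
    norm_exp_neg_I_mul_pi_mul] at h
  have := mul_le_mul_of_nonneg_right (norm_sub_I_mul_le hp hz)
    (Real.exp_pos (-(Real.pi * z.im))).le
  linarith

theorem secularFun_ne_zero_of_im_pos {p : ℝ} (hp : 0 < p) {z : ℂ} (hz : 0 < z.im) :
    secularFun p z ≠ 0 := by
  rw [← norm_pos_iff]
  refine lt_of_lt_of_le (mul_pos (norm_add_I_mul_pos hp hz.le) ?_) (le_norm_secularFun hp hz.le)
  have := mul_pos Real.pi_pos hz
  exact sub_pos.2 (Real.exp_lt_exp.2 (by linarith))

theorem norm_abelPlana_le {p : ℝ} (hp : 0 < p) (t : ℝ) {z : ℂ} (hz : 0 < z.im) :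
    ‖abelPlanaNum p t z / secularFun p z‖ ≤
      2 * Real.exp (-(t * z.re)) / (Real.exp (2 * Real.pi * z.im) - 1) := by
  have hpz := mul_pos Real.pi_pos hz
  have h1 : 0 < Real.exp (2 * Real.pi * z.im) - 1 := by
    rw [sub_pos, Real.one_lt_exp_iff]; linarith
  rw [norm_div, div_le_div_iff₀ (norm_pos_iff.2 (secularFun_ne_zero_of_im_pos hp hz)) h1,
    abelPlanaNum, norm_mul, norm_mul, norm_mul, norm_exp_neg_mul, norm_exp_I_mul_pi_mul]
  have h2 : Real.exp (-(Real.pi * z.im)) * (Real.exp (2 * Real.pi * z.im) - 1) =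
      Real.exp (Real.pi * z.im) - Real.exp (-(Real.pi * z.im)) := by
    rw [mul_sub, ← Real.exp_add, mul_one]; congr 2; ring
  have h3 := le_norm_secularFun hp hz.le
  have h4 := norm_sub_I_mul_le hp hz.le
  have h5 : 0 ≤ Real.exp (Real.pi * z.im) - Real.exp (-(Real.pi * z.im)) := by
    rw [← h2]; positivity
  have h6 : ‖z - Complex.I * p‖ *
      (Real.exp (Real.pi * z.im) - Real.exp (-(Real.pi * z.im))) ≤ ‖secularFun p z‖ :=
    (mul_le_mul_of_nonneg_right h4 h5).trans h3
  have h7 : ‖(2 : ℂ) * Complex.I‖ = 2 := by simp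
  rw [h7, ← h2] at *
  calc _ = 2 * Real.exp (-(t * z.re)) * (‖z - Complex.I * p‖ * (Real.exp (-(Real.pi * z.im)) *
        (Real.exp (2 * Real.pi * z.im) - 1))) := by ring
    _ ≤ _ := by gcongr

theorem abelPlana_im_ofReal {p t x : ℝ}
    (hx : p * Real.sin (Real.pi * x) + x * Real.cos (Real.pi * x) ≠ 0) :
    (abelPlanaNum p t x / secularFun p x).im = Real.exp (-(t * x)) := by
  rw [abelPlanaNum_ofReal, secularFun_ofReal, Complex.div_ofReal_im]
  simp only [Complex.add_im, Complex.ofReal_im, Complex.im_ofReal_mul, Complex.I_im]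
  generalize p * Real.sin (Real.pi * x) + x * Real.cos (Real.pi * x) = c at hx
  simp
  field_simp

theorem lt_abelPlanaKernel_den {p y : ℝ} (hy : 0 < y) :
    (p + y) * (Real.exp (2 * Real.pi * y) - 1) < (p + y) * Real.exp (2 * Real.pi * y) - (p - y) := by
  linarith

theorem abelPlana_re_mul_I {p t y : ℝ} (hp : 0 < p) (hy : 0 < y) :
    (abelPlanaNum p t (y * Complex.I) / secularFun p (y * Complex.I)).re =
      -(2 * (Real.sin (t * y) * abelPlanaKernel p y)) := by
  have hpy := mul_pos Real.pi_pos hy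
  have hd : 0 < (p + y) * Real.exp (2 * Real.pi * y) - (p - y) := by
    refine lt_trans (mul_pos (by linarith) ?_) (lt_abelPlanaKernel_den hy)
    rw [sub_pos, Real.one_lt_exp_iff]; linarith
  have e1 : Complex.I * Real.pi * (y * Complex.I) = ((-(Real.pi * y) : ℝ) : ℂ) := by
    push_cast; linear_combination (Real.pi * y : ℂ) * Complex.I_sq
  have hE : Real.exp (Real.pi * y) = Real.exp (-(Real.pi * y)) * Real.exp (2 * Real.pi * y) := by
    rw [← Real.exp_add]; congr 1; ring
  have hN : abelPlanaNum p t (y * Complex.I) =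
      Complex.exp ((-(t * y) : ℝ) * Complex.I) *
        ((2 * (p - y) * Real.exp (-(Real.pi * y)) : ℝ) : ℂ) := by
    rw [abelPlanaNum, e1, ← Complex.ofReal_exp]
    push_cast
    rw [show (-(t * (y * Complex.I)) : ℂ) = -(t * y) * Complex.I by ring]
    linear_combination (2 * (y - p) * Complex.exp (-(t * y) * Complex.I) *
      Complex.exp (-(Real.pi * y))) * Complex.I_sq
  have hH : secularFun p (y * Complex.I) = Complex.I * ((Real.exp (-(Real.pi * y)) *
      ((p + y) * Real.exp (2 * Real.pi * y) - (p - y)) : ℝ) : ℂ) := by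
    rw [secularFun, e1, ← Complex.ofReal_neg, ← Complex.ofReal_exp, ← Complex.ofReal_exp, neg_neg,
      hE]
    push_cast
    ring
  rw [hN, hH, Complex.exp_mul_I, abelPlanaKernel]
  have hx := (Real.exp_pos (-(Real.pi * y))).ne'
  have : ∀ u v w : ℝ, w ≠ 0 →
      ((Complex.cos (u : ℝ) + Complex.sin (u : ℝ) * Complex.I) * (v : ℂ) / (Complex.I * (w : ℂ))).re
        = Real.sin u * v / w := by
    intro u v w hw
    have : (Complex.cos (u : ℝ) + Complex.sin (u : ℝ) * Complex.I) * (v : ℂ) / (Complex.I * (w : ℂ))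
        = ((Real.sin u * v / w : ℝ) : ℂ) + ((-(Real.cos u * v / w) : ℝ) : ℂ) * Complex.I := by
      have hw' : (w : ℂ) ≠ 0 := Complex.ofReal_ne_zero.2 hw
      push_cast
      field_simp
      linear_combination (Complex.cos u) * (v : ℂ) * Complex.I_sq
    rw [this, Complex.add_re, Complex.ofReal_re, Complex.re_ofReal_mul, Complex.I_re, mul_zero,
      add_zero]
  rw [this _ _ _ (mul_ne_zero hx hd.ne'), Real.sin_neg]
  field_simp

/-- The bound must hold down to `y = 0`, where `norm_abelPlana_le` degenerates. At integer real part
both exponentials carry the same unit factor, and without it the denominator has real part `N (exp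
(-π y) + exp (π y)) ≥ 1`. -/
theorem norm_abelPlana_le_of_re_eq_nat {p t y : ℝ} (hp : 0 < p) (hy : 0 ≤ y) {N : ℕ}
    (hN : 1 ≤ N) :
    ‖abelPlanaNum p t (N + y * Complex.I) / secularFun p (N + y * Complex.I)‖ ≤
      2 * (N + y + p) * Real.exp (-(t * N)) := by
  have hN' : (1 : ℝ) ≤ N := by exact_mod_cast hN
  have hpy := mul_nonneg Real.pi_pos.le hy
  set z : ℂ := N + y * Complex.I with hz
  have hre : z.re = N := by simp [hz]
  have him : z.im = y := by simp [hz]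
  have e1 : Complex.exp (Complex.I * Real.pi * z) =
      Complex.exp (Complex.I * Real.pi * N) * ((Real.exp (-(Real.pi * y)) : ℝ) : ℂ) := by
    rw [Complex.ofReal_exp, ← Complex.exp_add, hz]; congr 1; push_cast
    linear_combination (Real.pi * y : ℂ) * Complex.I_sq
  have e2 : Complex.exp (-(Complex.I * Real.pi * z)) =
      Complex.exp (Complex.I * Real.pi * N) * ((Real.exp (Real.pi * y) : ℝ) : ℂ) := by
    rw [Complex.ofReal_exp, ← Complex.exp_add, hz, Complex.exp_eq_exp_iff_exists_int]
    refine ⟨-N, ?_⟩; push_cast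
    linear_combination (-Real.pi * y : ℂ) * Complex.I_sq
  have hden : 1 ≤ ‖secularFun p z‖ := by
    have e3 : secularFun p z = Complex.exp (Complex.I * Real.pi * N) *
        ((z - Complex.I * p) * ((Real.exp (-(Real.pi * y)) : ℝ) : ℂ) +
          (z + Complex.I * p) * ((Real.exp (Real.pi * y) : ℝ) : ℂ)) := by
      rw [secularFun, e1, e2]; ring
    have e4 : ‖Complex.exp (Complex.I * Real.pi * N)‖ = 1 := by
      rw [Complex.norm_exp]; simp
    rw [e3, norm_mul, e4, one_mul]
    refine le_trans ?_ (Complex.re_le_norm _)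
    simp only [Complex.add_re, Complex.re_mul_ofReal, Complex.sub_re, hre]
    have h1 := Real.exp_pos (-(Real.pi * y))
    have h2 := Real.one_le_exp hpy
    simp
    nlinarith
  have hnum : ‖abelPlanaNum p t z‖ ≤ 2 * (N + y + p) * Real.exp (-(t * N)) := by
    rw [abelPlanaNum, norm_mul, norm_mul, norm_mul, norm_exp_neg_mul, norm_exp_I_mul_pi_mul, hre,
      him]
    have h1 : ‖z - Complex.I * p‖ ≤ N + y + p := by
      refine (norm_sub_le _ _).trans (add_le_add ((norm_add_le _ _).trans ?_) ?_)
      · simp [abs_of_nonneg hy]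
      · simp [abs_of_pos hp]
    have h2 : Real.exp (-(Real.pi * y)) ≤ 1 := Real.exp_le_one_iff.2 (by linarith)
    have h7 : ‖(2 : ℂ) * Complex.I‖ = 2 := by simp
    rw [h7]
    have h3 : ‖z - Complex.I * p‖ * Real.exp (-(Real.pi * y)) ≤ (N + y + p) * 1 := by
      gcongr
    have h4 := mul_le_mul_of_nonneg_left h3 (Real.exp_pos (-(t * N))).le
    nlinarith
  rw [norm_div]
  exact (div_le_self (norm_nonneg _) hden).trans hnum

end

/-! ### Decay and integrability of the kernel. -/

theorem two_pi_mul_exp_le {y : ℝ} (hpy : 0 ≤ Real.pi * y) :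
    2 * (Real.pi * y) * Real.exp (Real.pi * y) ≤ Real.exp (2 * Real.pi * y) - 1 := by
  have h := Real.self_le_sinh_iff.2 hpy
  rw [Real.sinh_eq] at h
  have h2 : Real.exp (2 * Real.pi * y) - 1 =
      (Real.exp (Real.pi * y) - Real.exp (-(Real.pi * y))) * Real.exp (Real.pi * y) := by
    rw [sub_mul, ← Real.exp_add, ← Real.exp_add, neg_add_cancel, Real.exp_zero]
    congr 2; ring
  rw [h2]
  exact mul_le_mul_of_nonneg_right (by linarith) (Real.exp_pos _).le

/-- The kernel behaves like a multiple of `1 / y` at `0`; the factor `y` absorbs this, so one bound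
serves both ends of `(0, ∞)`. -/
theorem abs_mul_abelPlanaKernel_le {p y : ℝ} (hp : 0 < p) (hy : 0 < y) :
    |y * abelPlanaKernel p y| ≤ Real.exp (-(Real.pi * y)) := by
  have hpy := mul_pos Real.pi_pos hy
  have h1 := two_pi_mul_exp_le hpy.le
  have h2 := lt_abelPlanaKernel_den (p := p) hy
  have h3 : 0 < 2 * (Real.pi * y) * Real.exp (Real.pi * y) := by positivity
  have h4 : (p + y) * (2 * (Real.pi * y) * Real.exp (Real.pi * y)) ≤
      (p + y) * Real.exp (2 * Real.pi * y) - (p - y) :=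
    (mul_le_mul_of_nonneg_left h1 (by linarith)).trans h2.le
  have h5 : |p - y| ≤ p + y := abs_le.2 ⟨by linarith, by linarith⟩
  have h6 : 0 < (p + y) * Real.exp (2 * Real.pi * y) - (p - y) :=
    lt_of_lt_of_le (mul_pos (by linarith) h3) h4
  rw [abelPlanaKernel, abs_mul, abs_div, abs_of_pos hy, abs_of_pos h6, ← mul_div_assoc,
    div_le_iff₀ h6]
  have h7 : Real.exp (-(Real.pi * y)) * Real.exp (Real.pi * y) = 1 := by
    rw [← Real.exp_add]; simp
  calc y * |p - y| ≤ y * (p + y) := by gcongr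
    _ ≤ 2 * Real.pi * (y * (p + y)) := by
        have : 0 ≤ y * (p + y) := by positivity
        nlinarith [Real.pi_gt_three]
    _ = Real.exp (-(Real.pi * y)) * ((p + y) * (2 * (Real.pi * y) * Real.exp (Real.pi * y))) := by
        linear_combination (-(p + y) * 2 * Real.pi * y) * h7
    _ ≤ _ := by gcongr

theorem measurable_abelPlanaKernel (p : ℝ) : Measurable (abelPlanaKernel p) := by
  unfold abelPlanaKernel; fun_prop

theorem integrableOn_exp_neg_pi_add {a : ℝ} (ha : a < Real.pi) :
    MeasureTheory.IntegrableOn (fun y : ℝ => Real.exp (a * y) * Real.exp (-(Real.pi * y)))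
      (Set.Ioi 0) := by
  refine (integrableOn_exp_mul_Ioi (a := a - Real.pi) (by linarith) 0).congr_fun (fun y _ => ?_)
    measurableSet_Ioi
  simp only []
  rw [← Real.exp_add]; congr 1; ring

theorem integrableOn_pow_mul_abelPlanaKernel {p : ℝ} (hp : 0 < p) (n : ℕ) :
    MeasureTheory.IntegrableOn (fun y : ℝ => y ^ (n + 1) * abelPlanaKernel p y) (Set.Ioi 0) := by
  refine MeasureTheory.Integrable.mono'
    ((integrableOn_exp_neg_pi_add (a := 1) (by linarith [Real.pi_gt_three])).const_mul
      (n.factorial : ℝ))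
    (((measurable_id.pow_const _).mul (measurable_abelPlanaKernel p)).aestronglyMeasurable) ?_
  filter_upwards [MeasureTheory.ae_restrict_mem measurableSet_Ioi] with y hy
  have hy : 0 < y := hy
  have h1 := Real.pow_div_factorial_le_exp y hy.le n
  -- Bounding `y ^ n` by `n! exp y` costs rate `1`, which is less than the available `π`.
  rw [div_le_iff₀ (by positivity)] at h1
  rw [Real.norm_eq_abs, pow_succ, mul_assoc, abs_mul, abs_of_pos (pow_pos hy n), one_mul,
    ← mul_assoc]
  exact mul_le_mul (by linarith) (abs_mul_abelPlanaKernel_le hp hy) (abs_nonneg _) (by positivity)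

theorem integrableOn_sin_mul_abelPlanaKernel {p : ℝ} (hp : 0 < p) {t : ℝ} (ht : 0 < t) :
    MeasureTheory.IntegrableOn (fun y : ℝ => Real.sin (t * y) * abelPlanaKernel p y)
      (Set.Ioi 0) := by
  refine MeasureTheory.Integrable.mono'
    ((integrableOn_exp_neg_pi_add (a := 0) Real.pi_pos).const_mul t)
    ((((measurable_id.const_mul t).sin).mul (measurable_abelPlanaKernel p)).aestronglyMeasurable) ?_
  filter_upwards [MeasureTheory.ae_restrict_mem measurableSet_Ioi] with y hy
  have hy : 0 < y := hy
  have h1 : |Real.sin (t * y)| ≤ t * y := by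
    simpa [abs_of_pos ht, abs_of_pos hy] using Real.abs_sin_le_abs (x := t * y)
  have h2 := abs_mul_abelPlanaKernel_le hp hy
  rw [abs_mul, abs_of_pos hy] at h2
  rw [Real.norm_eq_abs, abs_mul, zero_mul, Real.exp_zero, one_mul]
  calc _ ≤ t * y * |abelPlanaKernel p y| := by gcongr
    _ = t * (y * |abelPlanaKernel p y|) := by ring
    _ ≤ _ := by gcongr

/-! ### Summation over the roots and the integral formula for the series. -/

theorem koshliakov_partial_sum {p : ℝ} (hp : 0 < p) (t : ℝ) (ht : 0 < t) {N : ℕ} (hN : 1 ≤ N) :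
    |∑ j ∈ Finset.range N, (p ^ 2 + koshliakovRoot p (j + 1) ^ 2) /
          (p * (p + 1 / Real.pi) + koshliakovRoot p (j + 1) ^ 2) *
        Real.exp (-koshliakovRoot p (j + 1) * t) -
      ((1 - Real.exp (-(t * N))) / t - p ^ 2 / (p * (p + 1 / Real.pi)) / 2 +
        2 * ∫ y in (0 : ℝ)..N, Real.sin (t * y) * abelPlanaKernel p y)| ≤
      2 * (2 * N + p) * Real.exp (-(t * N)) * N + 2 / (Real.exp (2 * Real.pi * N) - 1) * N := by
  have hpi := Real.pi_pos
  have hN0 : (0 : ℝ) < N := by exact_mod_cast hN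
  have hmono := koshliakovRoot_strictMono hp
  have hroot := fun j => (koshliakovRoot_spec hp j).1
  have hnn : ∀ j, 0 ≤ koshliakovRoot p j := fun j => hmono.monotone (Nat.zero_le j)
  set s : Finset ℝ := (Finset.range (N + 1)).image (koshliakovRoot p) with hs
  set r : ℝ → ℝ := fun x => (p ^ 2 + x ^ 2) / (Real.pi * (p ^ 2 + x ^ 2) + p) *
    Real.exp (-(t * x)) with hr
  set f : ℂ → ℂ := fun z => abelPlanaNum p t z / secularFun p z with hf
  have hnotin : ∀ x : ℝ, 0 ≤ x → x ≤ N → x ∉ s →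
      p * Real.sin (Real.pi * x) + x * Real.cos (Real.pi * x) ≠ 0 := by
    intro x hx hxN hxs h0
    obtain ⟨j, hj, rfl⟩ := exists_eq_koshliakovRoot hp hx h0
    refine hxs (Finset.mem_image.2 ⟨j, Finset.mem_range.2 ?_, rfl⟩)
    have : (j : ℝ) < N + 1 := by linarith
    exact_mod_cast this
  have main := integral_boundary_square_of_real_poles f s r hN0 (by
      intro a ha
      obtain ⟨j, hj, rfl⟩ := Finset.mem_image.1 ha
      exact ⟨hnn j, koshliakovRoot_lt hp (Nat.lt_succ_iff.1 (Finset.mem_range.1 hj)) hN⟩)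
    (by
      intro z hz1 hz2 hzs
      refine (differentiable_abelPlanaNum p t z).div (differentiable_secularFun p z) ?_
      rcases hz2.1.eq_or_lt with h | h
      · have hz : z = (z.re : ℂ) := Complex.ext (by simp) (by simp [← h])
        rw [hz, secularFun_ofReal, Complex.ofReal_ne_zero]
        refine mul_ne_zero two_ne_zero (hnotin _ hz1.1 hz1.2 fun hm => hzs _ hm hz)
      · exact secularFun_ne_zero_of_im_pos hp h)
    (by
      intro a ha
      obtain ⟨j, hj, rfl⟩ := Finset.mem_image.1 ha
      obtain ⟨h1, h2⟩ := residue_at_secular_root hp t (hroot j)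
      have h := tendsto_sub_residue_of_simple_zero (differentiable_abelPlanaNum p t)
        (differentiable_secularFun p) (a := (koshliakovRoot p j : ℂ))
        (by rw [secularFun_ofReal, hroot j]; simp) h1
      rwa [h2] at h)
  have hbottom : ∫ x in (0 : ℝ)..N, (f x).im = (1 - Real.exp (-(t * N))) / t := by
    have : ∫ x in (0 : ℝ)..N, (f x).im = ∫ x in (0 : ℝ)..N, Real.exp (-t * x) := by
      refine intervalIntegral.integral_congr_ae ?_
      have hae : ∀ᵐ x : ℝ, x ∉ (s : Set ℝ) :=
        s.finite_toSet.measure_zero _ |> MeasureTheory.measure_eq_zero_iff_ae_notMem.1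
      filter_upwards [hae] with x hx hx'
      rw [Set.uIoc_of_le hN0.le] at hx'
      rw [hf, abelPlana_im_ofReal (hnotin x hx'.1.le hx'.2 hx), neg_mul]
    rw [this, intervalIntegral.integral_comp_mul_left (fun x => Real.exp x) (neg_ne_zero.2 ht.ne'),
      integral_exp]
    simp
    field_simp
    ring
  have hleft : ∫ y in (0 : ℝ)..N, (f (y * Complex.I)).re =
      -(2 * ∫ y in (0 : ℝ)..N, Real.sin (t * y) * abelPlanaKernel p y) := by
    rw [← intervalIntegral.integral_const_mul, ← intervalIntegral.integral_neg]
    refine intervalIntegral.integral_congr_ae (Filter.Eventually.of_forall fun y hy => ?_)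
    rw [Set.uIoc_of_le hN0.le] at hy
    exact abelPlana_re_mul_I hp hy.1
  have hright : |∫ y in (0 : ℝ)..N, (f (N + y * Complex.I)).re| ≤
      2 * (2 * N + p) * Real.exp (-(t * N)) * N := by
    have := intervalIntegral.norm_integral_le_of_norm_le_const (a := 0) (b := (N : ℝ))
      (f := fun y : ℝ => (f (N + y * Complex.I)).re)
      (C := 2 * (2 * N + p) * Real.exp (-(t * N))) (by
        intro y hy
        rw [Set.uIoc_of_le hN0.le] at hy
        refine (Complex.abs_re_le_norm _).trans
          ((norm_abelPlana_le_of_re_eq_nat hp hy.1.le hN).trans ?_)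
        gcongr
        linarith [hy.2])
    simpa using this
  have htop : |∫ x in (0 : ℝ)..N, (f (x + (N : ℝ) * Complex.I)).im| ≤
      2 / (Real.exp (2 * Real.pi * N) - 1) * N := by
    have := intervalIntegral.norm_integral_le_of_norm_le_const (a := 0) (b := (N : ℝ))
      (f := fun x : ℝ => (f (x + (N : ℝ) * Complex.I)).im)
      (C := 2 / (Real.exp (2 * Real.pi * N) - 1)) (by
        intro x hx
        rw [Set.uIoc_of_le hN0.le] at hx
        have h1 : 0 < Real.exp (2 * Real.pi * N) - 1 := by
          rw [sub_pos, Real.one_lt_exp_iff]; positivity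
        refine (Complex.abs_im_le_norm _).trans
          ((norm_abelPlana_le hp t (by simpa using hN0)).trans ?_)
        have h2 : Real.exp (-(t * x)) ≤ 1 := Real.exp_le_one_iff.2 (by nlinarith [hx.1])
        simp
        gcongr
        linarith)
    simpa using this
  have hsum : ∑ a ∈ s, r a * (if a = 0 then Real.pi / 2 else Real.pi) =
      ∑ j ∈ Finset.range N, (p ^ 2 + koshliakovRoot p (j + 1) ^ 2) /
          (p * (p + 1 / Real.pi) + koshliakovRoot p (j + 1) ^ 2) * Real.exp (-koshliakovRoot p (j + 1) * t) +
        p ^ 2 / (p * (p + 1 / Real.pi)) / 2 := by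
    have hr' : ∀ x, r x * Real.pi = (p ^ 2 + x ^ 2) / (p * (p + 1 / Real.pi) + x ^ 2) *
        Real.exp (-x * t) := by
      intro x
      have h1 : Real.pi * (p ^ 2 + x ^ 2) + p = Real.pi * (p * (p + 1 / Real.pi) + x ^ 2) := by
        field_simp; ring
      have h2 : 0 < p * (p + 1 / Real.pi) + x ^ 2 := by positivity
      simp only [hr]
      rw [h1, show -x * t = -(t * x) by ring]
      field_simp
    have h00 : koshliakovRoot p 0 = 0 := rfl
    rw [hs, Finset.sum_image fun a _ b _ h => hmono.injective h, Finset.sum_range_succ', h00]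
    refine congrArg₂ _ (Finset.sum_congr rfl fun j _ => ?_) ?_
    · rw [if_neg, hr']
      exact (h00 ▸ hmono (Nat.succ_pos j)).ne'
    · rw [if_pos rfl, ← mul_div_assoc, hr']
      simp
  -- The error is now exactly the right-side integral minus the top-side integral.
  rw [hbottom, hleft, hsum] at main
  push_cast at main htop
  rw [show ∀ S c A K : ℝ, S - (A - c + K) = S + c - (A + K) by intros; ring, ← main,
    show ∀ A T R K : ℝ, A - T + R - -K - (A + K) = R - T by intros; ring]
  exact (abs_sub _ _).trans (add_le_add hright htop)

theorem koshliakovSeries_eq {p : ℝ} (hp : 0 < p) {t : ℝ} (ht : 0 < t) :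
    koshliakovSeries p t = 1 / t - p ^ 2 / (p * (p + 1 / Real.pi)) / 2 +
      2 * ∫ y in Set.Ioi (0 : ℝ), Real.sin (t * y) * abelPlanaKernel p y := by
  have hpi := Real.pi_pos
  have hnat := tendsto_natCast_atTop_atTop (R := ℝ)
  have hexp : ∀ k : ℕ, Filter.Tendsto (fun N : ℕ => (N : ℝ) ^ k * Real.exp (-(t * N)))
      Filter.atTop (nhds 0) := by
    intro k
    have h1 : Real.exp (-t) < 1 := Real.exp_lt_one_iff.2 (by linarith)
    refine (tendsto_pow_const_mul_const_pow_of_abs_lt_one k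
      (by rwa [abs_of_pos (Real.exp_pos _)] : |Real.exp (-t)| < 1)).congr fun N => ?_
    rw [← Real.exp_nat_mul]; congr 2; ring
  have hexp2 : Filter.Tendsto (fun N : ℕ => Real.exp (-(Real.pi * N))) Filter.atTop (nhds 0) :=
    Real.tendsto_exp_neg_atTop_nhds_zero.comp (hnat.const_mul_atTop hpi)
  have herr : Filter.Tendsto (fun N : ℕ => 2 * (2 * (N : ℝ) + p) * Real.exp (-(t * N)) * N +
      2 / (Real.exp (2 * Real.pi * N) - 1) * N) Filter.atTop (nhds 0) := by
    have h1 := ((hexp 2).const_mul 4).add ((hexp 1).const_mul (2 * p))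
    have h2 := h1.add hexp2
    simp only [mul_zero, add_zero] at h2
    refine squeeze_zero' ?_ ?_ h2
    · filter_upwards [Filter.eventually_ge_atTop 1] with N hN
      have hN0 : (0 : ℝ) < N := by exact_mod_cast hN
      have h1 : 0 < Real.exp (2 * Real.pi * N) - 1 := by
        rw [sub_pos, Real.one_lt_exp_iff]; positivity
      positivity
    · filter_upwards [Filter.eventually_ge_atTop 1] with N hN
      have hN0 : (0 : ℝ) < N := by exact_mod_cast hN
      have h1 : 0 < Real.exp (2 * Real.pi * N) - 1 := by
        rw [sub_pos, Real.one_lt_exp_iff]; positivity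
      have h3 := two_pi_mul_exp_le (y := N) (by positivity)
      have h4 : 2 / (Real.exp (2 * Real.pi * N) - 1) * N ≤ Real.exp (-(Real.pi * N)) := by
        rw [Real.exp_neg, div_mul_eq_mul_div, div_le_iff₀ h1, inv_mul_eq_div,
          le_div_iff₀ (Real.exp_pos _)]
        refine le_trans ?_ h3
        have := mul_pos hN0 (Real.exp_pos (Real.pi * N))
        nlinarith [Real.pi_gt_three]
      have h5 : 2 * (2 * (N : ℝ) + p) * Real.exp (-(t * N)) * N =
          4 * ((N : ℝ) ^ 2 * Real.exp (-(t * N))) + 2 * p * ((N : ℝ) ^ 1 * Real.exp (-(t * N))) := by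
        ring
      rw [h5]
      gcongr
  have hmain : Filter.Tendsto (fun N : ℕ => (1 - Real.exp (-(t * N))) / t -
      p ^ 2 / (p * (p + 1 / Real.pi)) / 2 +
        2 * ∫ y in (0 : ℝ)..N, Real.sin (t * y) * abelPlanaKernel p y) Filter.atTop
      (nhds (1 / t - p ^ 2 / (p * (p + 1 / Real.pi)) / 2 +
        2 * ∫ y in Set.Ioi (0 : ℝ), Real.sin (t * y) * abelPlanaKernel p y)) := by
    have h0 := hexp 0
    simp only [pow_zero, one_mul] at h0
    have h1 := (h0.const_sub 1).div_const t
    rw [sub_zero] at h1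
    exact (h1.sub_const _).add ((MeasureTheory.intervalIntegral_tendsto_integral_Ioi 0
      (integrableOn_sin_mul_abelPlanaKernel hp ht) hnat).const_mul 2)
  set S : ℕ → ℝ := fun N => ∑ j ∈ Finset.range N, (p ^ 2 + koshliakovRoot p (j + 1) ^ 2) /
    (p * (p + 1 / Real.pi) + koshliakovRoot p (j + 1) ^ 2) *
      Real.exp (-koshliakovRoot p (j + 1) * t) with hS
  set A : ℕ → ℝ := fun N => (1 - Real.exp (-(t * N))) / t -
    p ^ 2 / (p * (p + 1 / Real.pi)) / 2 +
      2 * ∫ y in (0 : ℝ)..N, Real.sin (t * y) * abelPlanaKernel p y with hA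
  have hdiff := squeeze_zero_norm' (f := fun N => S N - A N) (a := fun N : ℕ => 2 * (2 * (N : ℝ) + p) * Real.exp (-(t * N)) * N
    + 2 / (Real.exp (2 * Real.pi * N) - 1) * N)
    (by filter_upwards [Filter.eventually_ge_atTop 1] with N hN
        exact koshliakov_partial_sum hp t ht hN) herr
  have hlim := hdiff.add hmain
  simp only [sub_add_cancel, zero_add] at hlim
  -- The terms are nonnegative, so convergence of the partial sums already gives summability.
  refine HasSum.tsum_eq ((hasSum_iff_tendsto_nat_of_nonneg (fun j => ?_) _).2 hlim)
  positivity

/-! ### Power series expansion and uniqueness of the coefficients. -/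

/-- Dominated convergence: the majorants sum to `cosh (t y) exp (-π y)`, integrable because `t < 1 <
π`. -/
theorem hasSum_integral_sin_mul_abelPlanaKernel {p : ℝ} (hp : 0 < p) {t : ℝ} (ht : 0 < t)
    (ht1 : t < 1) :
    HasSum (fun m : ℕ => (-1) ^ m * t ^ (2 * m + 1) / ((2 * m + 1).factorial : ℝ) *
        ∫ y in Set.Ioi (0 : ℝ), y ^ (2 * m + 1) * abelPlanaKernel p y)
      (∫ y in Set.Ioi (0 : ℝ), Real.sin (t * y) * abelPlanaKernel p y) := by
  have hcosh : ∀ y : ℝ, HasSum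
      (fun m : ℕ => (t * y) ^ (2 * m) / ((2 * m).factorial : ℝ) * Real.exp (-(Real.pi * y)))
      (Real.cosh (t * y) * Real.exp (-(Real.pi * y))) := fun y =>
    (Real.hasSum_cosh (t * y)).mul_right _
  have h := MeasureTheory.hasSum_integral_of_dominated_convergence
    (μ := MeasureTheory.volume.restrict (Set.Ioi (0 : ℝ)))
    (F := fun (m : ℕ) y => (-1) ^ m * t ^ (2 * m + 1) / ((2 * m + 1).factorial : ℝ) *
      (y ^ (2 * m + 1) * abelPlanaKernel p y))
    (f := fun y => Real.sin (t * y) * abelPlanaKernel p y)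
    (fun m y => (t * y) ^ (2 * m) / ((2 * m).factorial : ℝ) * Real.exp (-(Real.pi * y)))
    (fun m => (((measurable_id.pow_const _).mul
      (measurable_abelPlanaKernel p)).const_mul _).aestronglyMeasurable) ?_
    (Filter.Eventually.of_forall fun y => (hcosh y).summable) ?_ ?_
  · simpa only [MeasureTheory.integral_const_mul] using h
  · intro m
    filter_upwards [MeasureTheory.ae_restrict_mem measurableSet_Ioi] with y hy
    have hy : 0 < y := hy
    have hf : ((2 * m).factorial : ℝ) ≤ ((2 * m + 1).factorial : ℝ) := by
      exact_mod_cast Nat.factorial_le (Nat.le_succ _)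
    have hf0 : (0 : ℝ) < ((2 * m).factorial : ℝ) := by positivity
    have e : (-1 : ℝ) ^ m * t ^ (2 * m + 1) / ((2 * m + 1).factorial : ℝ) *
        (y ^ (2 * m + 1) * abelPlanaKernel p y) =
        (-1 : ℝ) ^ m * (t * ((t * y) ^ (2 * m) / ((2 * m + 1).factorial : ℝ)) *
          (y * abelPlanaKernel p y)) := by ring
    rw [Real.norm_eq_abs, e, abs_mul, abs_pow, abs_neg, abs_one, one_pow, one_mul, abs_mul,
      abs_of_nonneg (by positivity : 0 ≤ t * ((t * y) ^ (2 * m) / ((2 * m + 1).factorial : ℝ)))]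
    refine mul_le_mul ?_ (abs_mul_abelPlanaKernel_le hp hy) (abs_nonneg _) (by positivity)
    calc _ ≤ 1 * ((t * y) ^ (2 * m) / ((2 * m).factorial : ℝ)) := by gcongr
      _ = _ := one_mul _
  · simp only [fun y => (hcosh y).tsum_eq]
    have h1 := integrableOn_exp_neg_pi_add (a := t) (by linarith [Real.pi_gt_three])
    have h2 := integrableOn_exp_neg_pi_add (a := -t) (by linarith [Real.pi_gt_three])
    refine ((h1.add h2).div_const 2).congr (Filter.Eventually.of_forall fun y => ?_)
    simp only [Pi.add_apply]
    rw [Real.cosh_eq, neg_mul]; ring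
  · refine Filter.Eventually.of_forall fun y => ?_
    have h := (Real.hasSum_sin (t * y)).mul_right (abelPlanaKernel p y)
    have e : ∀ m : ℕ, (-1) ^ m * t ^ (2 * m + 1) / ((2 * m + 1).factorial : ℝ) *
        (y ^ (2 * m + 1) * abelPlanaKernel p y) =
        (-1) ^ m * (t * y) ^ (2 * m + 1) / ((2 * m + 1).factorial : ℝ) * abelPlanaKernel p y :=
      fun m => by ring
    simp only [e]
    exact h

/-- Convergence at `1/2` gives a positive radius. The sum is then analytic at `0` and vanishes at
positive points accumulating there. -/
theorem coeff_eq_zero_of_hasSum_zero {d : ℕ → ℝ}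
    (h : ∀ t : ℝ, 0 < t → t < 1 → HasSum (fun n => d n * t ^ n) 0) : d = 0 := by
  set q := FormalMultilinearSeries.ofScalars ℝ d with hq
  have hr : ((1 / 2 : NNReal) : ENNReal) ≤ q.radius := by
    refine q.le_radius_of_tendsto (l := 0) ?_
    have := (h (1 / 2) (by norm_num) (by norm_num)).summable.tendsto_atTop_zero.norm
    rw [norm_zero] at this
    refine this.congr fun n => ?_
    rw [hq, FormalMultilinearSeries.ofScalars_norm]
    simp
  have hball := q.hasFPowerSeriesOnBall (lt_of_lt_of_le (by simp) hr)
  have hfreq : ∃ᶠ z in nhdsWithin (0 : ℝ) {0}ᶜ, q.sum z = 0 := by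
    have hev : ∀ᶠ z in nhdsWithin (0 : ℝ) (Set.Ioi 0), q.sum z = 0 := by
      filter_upwards [Ioo_mem_nhdsGT (zero_lt_one (α := ℝ))] with z hz
      rw [FormalMultilinearSeries.sum, ← (h z hz.1 hz.2).tsum_eq]
      simp [hq, mul_comm]
    exact hev.frequently.filter_mono (nhdsWithin_mono _ fun x hx => (ne_of_gt hx))
  have hq0 := hball.hasFPowerSeriesAt.eq_zero_of_eventually
    (hball.analyticAt.frequently_zero_iff_eventually_zero.1 hfreq)
  exact (FormalMultilinearSeries.ofScalars_series_eq_zero ℝ).1 hq0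

theorem HasSecondKindGenFun.unique {p : ℝ} {B C : ℕ → ℝ} (hB : HasSecondKindGenFun p B)
    (hC : HasSecondKindGenFun p C) : B = C := by
  have h := coeff_eq_zero_of_hasSum_zero
    (d := fun n => B n / (n.factorial : ℝ) - C n / (n.factorial : ℝ)) (fun t h0 h1 => by
      simpa [sub_mul] using (hB t h0 h1).sub (hC t h0 h1))
  funext n
  have hn := congrFun h n
  have hf : (n.factorial : ℝ) ≠ 0 := by positivity
  simp only [Pi.zero_apply] at hn
  field_simp at hn
  linarith

/-! ### The closed form of the coefficients and the conclusion. -/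

noncomputable section

/-- The closed form of the generalized Bernoulli numbers of the second kind. -/
def secondKindCoeff (p : ℝ) (n : ℕ) : ℝ :=
  if n = 0 then 1
  else if n = 1 then -(p ^ 2 / (p * (p + 1 / Real.pi)) / 2)
  else if Even n then
    2 * n * (-1) ^ (n / 2 + 1) * ∫ y in Set.Ioi (0 : ℝ), y ^ (n - 1) * abelPlanaKernel p y
  else 0

end

theorem secondKindCoeff_zero (p : ℝ) : secondKindCoeff p 0 = 1 := by
  simp [secondKindCoeff]

theorem secondKindCoeff_one (p : ℝ) :
    secondKindCoeff p 1 = -(p ^ 2 / (p * (p + 1 / Real.pi)) / 2) := by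
  simp [secondKindCoeff]

theorem secondKindCoeff_even (p : ℝ) {m : ℕ} (hm : 1 ≤ m) :
    secondKindCoeff p (2 * m) = 4 * m * (-1) ^ (m + 1) *
      ∫ y in Set.Ioi (0 : ℝ), y ^ (2 * m - 1) * abelPlanaKernel p y := by
  have h0 : 2 * m ≠ 0 := by omega
  have h1 : 2 * m ≠ 1 := by omega
  have h2 : 2 * m / 2 = m := by omega
  rw [secondKindCoeff, if_neg h0, if_neg h1, if_pos (even_two_mul m), h2]
  push_cast; ring

theorem secondKindCoeff_odd (p : ℝ) {m : ℕ} (hm : m ≠ 0) : secondKindCoeff p (2 * m + 1) = 0 := by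
  simp [secondKindCoeff, hm]

theorem hasSum_secondKindCoeff_even {p : ℝ} (hp : 0 < p) {t : ℝ} (ht : 0 < t) (ht1 : t < 1) :
    HasSum (fun m : ℕ => secondKindCoeff p (2 * m) / ((2 * m).factorial : ℝ) * t ^ (2 * m))
      (1 + 2 * t * ∫ y in Set.Ioi (0 : ℝ), Real.sin (t * y) * abelPlanaKernel p y) := by
  have h := (hasSum_integral_sin_mul_abelPlanaKernel hp ht ht1).mul_left (2 * t)
  have h1 : ∀ m : ℕ, 2 * t * ((-1) ^ m * t ^ (2 * m + 1) / ((2 * m + 1).factorial : ℝ) *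
        ∫ y in Set.Ioi (0 : ℝ), y ^ (2 * m + 1) * abelPlanaKernel p y) =
      secondKindCoeff p (2 * (m + 1)) / ((2 * (m + 1)).factorial : ℝ) * t ^ (2 * (m + 1)) := by
    intro m
    have hf : ((2 * m + 1).factorial : ℝ) ≠ 0 := by positivity
    have hm : (m : ℝ) + 1 ≠ 0 := by positivity
    have e2 : ((2 * (m + 1)).factorial : ℝ) = 2 * (m + 1) * ((2 * m + 1).factorial : ℝ) := by
      have : 2 * (m + 1) = (2 * m + 1) + 1 := by ring
      rw [this, Nat.factorial_succ]; push_cast; ring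
    have e3 : 2 * (m + 1) - 1 = 2 * m + 1 := by omega
    rw [secondKindCoeff_even p (Nat.le_add_left 1 m), e2, e3]
    generalize ((2 * m + 1).factorial : ℝ) = F at hf
    push_cast
    field_simp
    ring
  simp only [h1] at h
  have h2 : secondKindCoeff p (2 * 0) / ((2 * 0).factorial : ℝ) * t ^ (2 * 0) = 1 := by
    simp [secondKindCoeff_zero]
  have h3 := HasSum.zero_add (f := fun m : ℕ => secondKindCoeff p (2 * m) /
    ((2 * m).factorial : ℝ) * t ^ (2 * m)) h
  rwa [h2] at h3

theorem hasSum_secondKindCoeff_odd (p t : ℝ) :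
    HasSum (fun m : ℕ => secondKindCoeff p (2 * m + 1) / ((2 * m + 1).factorial : ℝ) *
      t ^ (2 * m + 1)) (-(p ^ 2 / (p * (p + 1 / Real.pi)) / 2) * t) := by
  have h := hasSum_single (f := fun m : ℕ => secondKindCoeff p (2 * m + 1) /
      ((2 * m + 1).factorial : ℝ) * t ^ (2 * m + 1)) 0 fun m hm => by
    rw [secondKindCoeff_odd p hm, zero_div, zero_mul]
  simpa only [mul_zero, zero_add, secondKindCoeff_one, Nat.factorial_one, Nat.cast_one, div_one,
    pow_one] using h

theorem hasSecondKindGenFun_secondKindCoeff {p : ℝ} (hp : 0 < p) :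
    HasSecondKindGenFun p (secondKindCoeff p) := by
  intro t ht ht1
  have h := HasSum.even_add_odd (f := fun n : ℕ => secondKindCoeff p n / (n.factorial : ℝ) * t ^ n)
    (hasSum_secondKindCoeff_even hp ht ht1) (hasSum_secondKindCoeff_odd p t)
  have e : t * koshliakovSeries p t =
      1 + 2 * t * (∫ y in Set.Ioi (0 : ℝ), Real.sin (t * y) * abelPlanaKernel p y) +
        -(p ^ 2 / (p * (p + 1 / Real.pi)) / 2) * t := by
    rw [koshliakovSeries_eq hp ht, mul_add, mul_sub, mul_one_div_cancel ht.ne']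
    ring
  rwa [e]

/-- Equality fails only at `y = p`: there division by zero makes `koshliakovSigma` equal to `0` and
the right side `-p ^ n`, whereas the kernel is `0`. -/
theorem mul_abelPlanaKernel_ae_eq (p : ℝ) (n : ℕ) :
    (fun y : ℝ => y ^ n * abelPlanaKernel p y)
      =ᵐ[MeasureTheory.volume.restrict (Set.Ioi (0 : ℝ))]
    fun x : ℝ => x ^ n / (koshliakovSigma p x * Real.exp (2 * Real.pi * x) - 1) := by
  filter_upwards [MeasureTheory.ae_restrict_mem measurableSet_Ioi,
    MeasureTheory.ae_restrict_of_ae (MeasureTheory.Measure.ae_ne MeasureTheory.volume p)] with y hy hyp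
  have h : p - y ≠ 0 := sub_ne_zero.2 hyp.symm
  rw [abelPlanaKernel, koshliakovSigma, div_mul_eq_mul_div, div_sub_one h, div_div_eq_mul_div,
    mul_div_assoc]

theorem mainTheorem4 (p : ℝ) (hp : 0 < p) :
    (∃! B : ℕ → ℝ, HasSecondKindGenFun p B) ∧
    HasSecondKindGenFun p (bernoulliSecondKind p) ∧
    (∀ m : ℕ, 1 ≤ m →
      MeasureTheory.IntegrableOn
        (fun x : ℝ => x ^ (2 * m - 1) /
          (koshliakovSigma p x * Real.exp (2 * Real.pi * x) - 1)) (Set.Ioi 0) ∧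
      bernoulliSecondKind p (2 * m) =
        4 * (m : ℝ) * (-1) ^ (m + 1) *
          ∫ x in Set.Ioi (0 : ℝ), x ^ (2 * m - 1) /
            (koshliakovSigma p x * Real.exp (2 * Real.pi * x) - 1)) ∧
    bernoulliSecondKind p 0 = 1 := by
  have h0 := hasSecondKindGenFun_secondKindCoeff hp
  have h1 : HasSecondKindGenFun p (bernoulliSecondKind p) := Classical.epsilon_spec ⟨_, h0⟩
  have h2 : bernoulliSecondKind p = secondKindCoeff p := h1.unique h0
  refine ⟨⟨_, h0, fun B hB => hB.unique h0⟩, h1, fun m hm => ?_, h2 ▸ secondKindCoeff_zero p⟩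
  have hae := mul_abelPlanaKernel_ae_eq p (2 * m - 1)
  refine ⟨?_, ?_⟩
  · have := integrableOn_pow_mul_abelPlanaKernel hp (2 * m - 2)
    rw [show 2 * m - 2 + 1 = 2 * m - 1 by omega] at this
    exact this.congr hae
  · rw [← MeasureTheory.integral_congr_ae hae, h2, secondKindCoeff_even p hm]
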